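/- Let $G=(V,E)$ be a finite connected simple graph with $N=|V|$ vertices and $M=|E|$ edges, let $d_i$ be the degree of $i\in V$, and let $J_{ij}$ ($ij\in E$) and $h_i$ ($i\in V$) be arbitrary real numbers. Let $L(G)\subset\mathbb{R}^{N+M}$ be the set of all $\{m_i,\chi_{ij}\}_{i\in V,\,ij\in E}$ such that $1+m_ix_i+m_jx_j+\chi_{ij}x_ix_j>0$ for all $ij\in E$ and $x_i,x_j\in\{\pm1\}$ and $1+m_ix_i>0$ for all $i\in V$ and $x_i\in\{\pm1\}$ (the second condition follows from the first as soon as $N\ge2$). With $\eta(x)=x\log x$, the Bethe free energy is $$F(\{m_i,\chi_{ij}\})=-\sum_{ij\in E}J_{ij}\chi_{ij}-\sum_{i\in V}h_im_i+\sum_{ij\in E}\sum_{x_i,x_j=\pm1}\eta\Big(\frac{1+m_ix_i+m_jx_j+\chi_{ij}x_ix_j}{4}\Big)+\sum_{i\in V}(1-d_i)\sum_{x_i=\pm1}\eta\Big(\frac{1+m_ix_i}{2}\Big),$$ and $\nabla^2F$ is its $(N+M)\times(N+M)$ Hessian matrix of second partial derivatives. For $-1<t<1$ the point $m_i(t)=0$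 ($i\in V$), $\chi_{ij}(t)=t$ ($ij\in E$) lies in $L(G)$; write $\nabla^2F(t)$ for the Hessian at this point. Then $$\lim_{t\to1^-}\det(\nabla^2F(t))\,(1-t)^{M+N-1}=-2^{-M-N+1}(M-N)\,\kappa(G),$$ where $\kappa(G)$ is the number of spanning trees of $G$. In particular, if $M-N\ge1$, then $F$ is not convex on $L(G)$. Moreover, $F$ is convex on $L(G)$ if and only if $G$ is a tree or a graph with exactly one cycle. -/

import Mathlib

open Filter Topology

noncomputable section

namespace Bethe

variable {V : Type*}

/-- The two spin values `±1`, as real numbers, are indexed by the units of `ℤ`. -/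
def spin (x : ℤˣ) : ℝ := ((x : ℤ) : ℝ)

/-- `η(x) = x log x`. -/
def eta (x : ℝ) : ℝ := x * Real.log x

/-- The coordinates `{m_i, χ_ij}`: one real number per vertex and one per undirected edge.
A point of `ℝ^(N+M)` is a function `q : Coord G → ℝ`, with `m_i = q (Sum.inl i)` and
`χ_e = q (Sum.inr e)`. -/
abbrev Coord (G : SimpleGraph V) : Type _ := V ⊕ G.edgeSet

/-- The domain `L(G)` of the Bethe free energy: all pseudomarginals
`b_i(x_i) = (1 + m_i x_i) / 2` and
`b_ij(x_i, x_j) = (1 + m_i x_i + m_j x_j + χ_ij x_i x_j) / 4` are positive.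
The condition at a vertex follows from the condition at any edge at that vertex
(see `mem_domain_iff`); it matters only for an isolated vertex. -/
def domain (G : SimpleGraph V) : Set (Coord G → ℝ) :=
  {q | (∀ (i : V) (x : ℤˣ), 0 < 1 + q (Sum.inl i) * spin x) ∧
    ∀ (i j : V) (hij : G.Adj i j) (x y : ℤˣ),
      0 < 1 + q (Sum.inl i) * spin x + q (Sum.inl j) * spin y
        + q (Sum.inr ⟨s(i, j), hij⟩) * spin x * spin y}

/-- In a connected graph with at least two vertices the edge conditions alone describe `L(G)`. -/
theorem mem_domain_iff [Nontrivial V] {G : SimpleGraph V} (hG : G.Connected) (q : Coord G → ℝ) :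
    q ∈ domain G ↔ ∀ (i j : V) (hij : G.Adj i j) (x y : ℤˣ),
      0 < 1 + q (Sum.inl i) * spin x + q (Sum.inl j) * spin y
        + q (Sum.inr ⟨s(i, j), hij⟩) * spin x * spin y := by
  refine ⟨fun hq => hq.2, fun hq => ⟨fun i x => ?_, hq⟩⟩
  obtain ⟨j, hij⟩ := hG.preconnected.exists_adj_of_nontrivial i
  have h1 := hq i j hij x 1
  have h2 := hq i j hij x (-1)
  simp only [spin, Units.val_neg, Units.val_one, Int.cast_neg, Int.cast_one] at h1 h2 ⊢
  linarith

/-- The sum `∑_{x_i, x_j = ±1} η(b_ij(x_i, x_j))` for an edge `ij` with correlation `c = χ_ij`;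
it is symmetric in the two endpoints, hence a function of the unordered pair. -/
def edgeEntropy (m : V → ℝ) (c : ℝ) : Sym2 V → ℝ :=
  Sym2.lift ⟨fun i j => ∑ x : ℤˣ, ∑ y : ℤˣ,
      eta ((1 + m i * spin x + m j * spin y + c * spin x * spin y) / 4), by
    intro i j
    beta_reduce
    rw [Finset.sum_comm]
    refine Finset.sum_congr rfl fun x _ => Finset.sum_congr rfl fun y _ => ?_
    congr 1
    ring⟩

variable [Fintype V] (G : SimpleGraph V) [DecidableRel G.Adj]

/-- The Bethe free energy of the binary model with interactions `J_ij`, `h_i`, in the coordinates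
`{m_i, χ_ij}`. -/
def freeEnergy [DecidableEq V] (J : G.edgeSet → ℝ) (h : V → ℝ) (q : Coord G → ℝ) : ℝ :=
  -(∑ e : G.edgeSet, J e * q (Sum.inr e)) - ∑ i : V, h i * q (Sum.inl i)
    + ∑ e : G.edgeSet, edgeEntropy (fun i => q (Sum.inl i)) (q (Sum.inr e)) (e : Sym2 V)
    + ∑ i : V, (1 - (G.degree i : ℝ)) * ∑ x : ℤˣ, eta ((1 + q (Sum.inl i) * spin x) / 2)

/-- The partial derivative of `f` in the coordinate `a`. -/
def partialDeriv {ι : Type*} [DecidableEq ι] (a : ι) (f : (ι → ℝ) → ℝ) (q : ι → ℝ) : ℝ :=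
  lineDeriv ℝ f q (Pi.single a 1)

/-- The Hessian matrix of second partial derivatives of `f` at `q`. -/
def hessian {ι : Type*} [DecidableEq ι] (f : (ι → ℝ) → ℝ) (q : ι → ℝ) : Matrix ι ι ℝ :=
  Matrix.of fun a b => partialDeriv a (partialDeriv b f) q

end Bethe

namespace Bethe

variable {V : Type*}

/-- The point `m_i = 0`, `χ_ij = t`. -/
def path (G : SimpleGraph V) (t : ℝ) : Coord G → ℝ := Sum.elim (fun _ => 0) (fun _ => t)

/-- The number `κ(G)` of spanning trees. -/
def numSpanningTrees (G : SimpleGraph V) : ℕ :=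
  Nat.card {T : SimpleGraph V // T ≤ G ∧ T.IsTree}

/-- `G` has exactly one cycle, a cycle being identified with its set of edges. -/
def HasExactlyOneCycle (G : SimpleGraph V) : Prop :=
  ∃! C : Set (Sym2 V), ∃ (v : V) (p : G.Walk v v), p.IsCycle ∧ {e | e ∈ p.edges} = C

end Bethe

end

/-! At `m = 0`, `χ = t` the spin flip symmetry kills the mixed derivatives, so the Hessian is block
diagonal. Up to the factor `(1 - t²)⁻¹` its edge block is the identity and its vertex block is `I -
tA + t²(D - I)`. At `t = 1` the latter is the Laplacian, which is singular. Its column sums are `(1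
- t)(1 + t - t d_j)`, so replacing one row by the sum of all rows extracts a factor `1 - t`. The
remaining determinant at `t = 1` expands along the row `2 - d_j` with all cofactors equal to `κ(G)`,
and is `2(N - M)κ(G)`. The cofactors come from the matrix-tree theorem, proved by multilinear
expansion over parent maps (`SimpleGraph.adjugate_lapMatrix_diag`).

For convexity, a connected graph has `M ≤ N` exactly when it is a tree or has one cycle. If `M ≤ N`,
the edges can be oriented with distinct tails. Then `F` is a linear form plus negative conditional
entropies of tails given heads, plus negative entropies of the vertices that are not tails, all
convex (`freeEnergy_eq_conditional`). If `M > N`, convexity already fails on the plane of constant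
`m = s`, `χ = t`: as `t → 1` the entropy part tends to `N - M` times a strictly convex function of
`s`. This argument does not go through the determinant. -/

noncomputable section

/-! ### Rooted spanning trees as parent maps -/

/-- The graph whose edges join each vertex other than the root `r` to its parent. -/
def parentGraph {V : Type*} (r : V) (f : V → V) : SimpleGraph V :=
  SimpleGraph.fromEdgeSet {e | ∃ i, i ≠ r ∧ e = s(i, f i)}

/-- `f` is the parent function of a tree rooted at `r`. -/
structure IsParentMap {V : Type*} (r : V) (f : V → V) : Prop where
  map_root : f r = r
  reaches : ∀ i, ∃ k, f^[k] i = r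

namespace IsParentMap

variable {V : Type*} {r : V} {f : V → V}

/-- The orbit of `i` stays in `{i, f i}` and must meet the fixed point `r`. -/
theorem eq_root_of_apply_apply (hf : IsParentMap r f) {i : V} (hi : f (f i) = i) : i = r := by
  obtain ⟨k, hk⟩ := hf.reaches i
  have key : ∀ k, f^[k] i = i ∨ f^[k] i = f i := by
    intro k
    induction k with
    | zero => exact Or.inl rfl
    | succ k ih =>
      rw [Function.iterate_succ_apply']
      rcases ih with h | h <;> rw [h]
      · exact Or.inr rfl
      · exact Or.inl hi
  rcases key k with h | h
  · rw [← h, hk]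
  · rw [← hi, ← h, hk, hf.map_root]

theorem apply_ne (hf : IsParentMap r f) {i : V} (hi : i ≠ r) : f i ≠ i := fun h =>
  hi (hf.eq_root_of_apply_apply (by rw [h, h]))

theorem parentGraph_adj (hf : IsParentMap r f) {a b : V} :
    (parentGraph r f).Adj a b ↔ ∃ i, i ≠ r ∧ s(a, b) = s(i, f i) := by
  simp only [parentGraph, SimpleGraph.fromEdgeSet_adj, Set.mem_ofPred_eq, and_iff_left_iff_imp]
  rintro ⟨i, hi, h⟩ rfl
  have := hf.apply_ne hi
  grind

theorem parentGraph_connected (hf : IsParentMap r f) : (parentGraph r f).Connected := by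
  have key : ∀ k i, f^[k] i = r → (parentGraph r f).Reachable i r := by
    intro k
    induction k with
    | zero => rintro i rfl; exact SimpleGraph.Reachable.refl _
    | succ k ih =>
      intro i hi
      by_cases h : i = r
      · rw [h]
      · exact (SimpleGraph.Adj.reachable (hf.parentGraph_adj.2 ⟨i, h, rfl⟩)).trans (ih _ hi)
  have reach : ∀ i, (parentGraph r f).Reachable i r := fun i =>
    let ⟨k, hk⟩ := hf.reaches i
    key k i hk
  exact (SimpleGraph.connected_iff _).2 ⟨fun i j => (reach i).trans (reach j).symm, ⟨r⟩⟩

/-- Non-root vertices index the edges, so there are at most `|V| - 1`; connectedness forces at least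
that many. -/
theorem parentGraph_isTree [Finite V] (hf : IsParentMap r f) : (parentGraph r f).IsTree := by
  refine SimpleGraph.isTree_iff_connected_and_card.2 ⟨hf.parentGraph_connected, ?_⟩
  refine le_antisymm ?_ hf.parentGraph_connected.card_vert_le_card_edgeSet_add_one
  have hsub : (parentGraph r f).edgeSet ⊆ (fun i => s(i, f i)) '' {r}ᶜ := by
    intro e
    induction e with
    | _ a b =>
      intro he
      obtain ⟨i, hi, h⟩ := hf.parentGraph_adj.1 he
      exact ⟨i, hi, h.symm⟩
  have h1 : (parentGraph r f).edgeSet.ncard ≤ ({r}ᶜ : Set V).ncard :=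
    (Set.ncard_le_ncard hsub).trans (Set.ncard_image_le (Set.toFinite _))
  have h2 := Set.ncard_add_ncard_compl ({r} : Set V)
  rw [Set.ncard_singleton] at h2
  rw [Nat.card_coe_set_eq]
  lia

theorem parentGraph_injective {g : V → V} (hf : IsParentMap r f) (hg : IsParentMap r g)
    (h : parentGraph r f = parentGraph r g) : f = g := by
  by_contra hne
  obtain ⟨i, hi⟩ := Function.ne_iff.1 hne
  -- The edge from `i` to `f i` is also a `g`-edge, and `g i ≠ f i` forces `g (f i) = i`. Agreement
  -- at `f i` would make `i` a point of period two, hence the root. So disagreement travels along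
  -- the orbit up to the root, where both maps agree.
  have step : ∀ i, f i ≠ g i → f (f i) ≠ g (f i) := by
    intro i hi hfi
    have hir : i ≠ r := by rintro rfl; exact hi (hf.map_root.trans hg.map_root.symm)
    have hadj : (parentGraph r g).Adj i (f i) := h ▸ hf.parentGraph_adj.2 ⟨i, hir, rfl⟩
    obtain ⟨j, -, hj⟩ := hg.parentGraph_adj.1 hadj
    rcases Sym2.eq_iff.1 hj with hj | hj
    · exact hi (by rw [hj.2, hj.1])
    · exact hir (hf.eq_root_of_apply_apply (by rw [hfi, hj.2, hj.1]))
  have all : ∀ k, f (f^[k] i) ≠ g (f^[k] i) := by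
    intro k
    induction k with
    | zero => exact hi
    | succ k ih => rw [Function.iterate_succ_apply']; exact step _ ih
  obtain ⟨k, hk⟩ := hf.reaches i
  exact all k (by rw [hk, hf.map_root, hg.map_root])

end IsParentMap

theorem SimpleGraph.IsTree.eq_of_le {V : Type*} [Finite V] {S T : SimpleGraph V} (hS : S.IsTree)
    (hT : T.IsTree) (h : S ≤ T) : S = T := by
  have hS' := (SimpleGraph.isTree_iff_connected_and_card.1 hS).2
  have hT' := (SimpleGraph.isTree_iff_connected_and_card.1 hT).2
  rw [Nat.card_coe_set_eq] at hS' hT'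
  exact SimpleGraph.edgeSet_inj.1
    (Set.eq_of_subset_of_ncard_le (SimpleGraph.edgeSet_mono h) (by lia) (Set.toFinite _))

/-- The parent is a neighbour strictly closer to `r`. The resulting tree lies inside `T`, and nested
trees on the same vertices coincide. -/
theorem SimpleGraph.IsTree.exists_parentMap {V : Type*} [Finite V] {T : SimpleGraph V}
    (hT : T.IsTree) (r : V) : ∃ f, IsParentMap r f ∧ parentGraph r f = T := by
  classical
  have hpar : ∀ i, i ≠ r → ∃ j, T.Adj i j ∧ T.dist j r < T.dist i r := by
    intro i hi
    obtain ⟨p, hp⟩ := hT.connected.exists_walk_length_eq_dist i r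
    cases p with
    | nil => exact absurd rfl hi
    | @cons _ j _ hadj p =>
      refine ⟨j, hadj, ?_⟩
      have := SimpleGraph.dist_le p
      rw [SimpleGraph.Walk.length_cons] at hp
      lia
  choose! g hadj hdist using hpar
  have hg : IsParentMap r (fun i => if i = r then r else g i) := by
    refine ⟨by simp, fun i => ?_⟩
    induction hn : T.dist i r using Nat.strong_induction_on generalizing i with
    | _ n ih =>
      by_cases hi : i = r
      · exact ⟨0, hi⟩
      · obtain ⟨k, hk⟩ := ih _ (hn ▸ hdist i hi) (g i) rfl
        exact ⟨k + 1, by rw [Function.iterate_succ_apply, if_neg hi, hk]⟩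
  refine ⟨_, hg, hg.parentGraph_isTree.eq_of_le hT fun a b hab => ?_⟩
  obtain ⟨i, hi, h⟩ := hg.parentGraph_adj.1 hab
  rw [if_neg hi] at h
  have := hadj i hi
  rwa [← SimpleGraph.mem_edgeSet, ← h, SimpleGraph.mem_edgeSet] at this

/-- Spanning trees of `G` correspond to parent maps along edges of `G`, for any root `r`. -/
theorem card_parentMaps {V : Type*} [Finite V] (G : SimpleGraph V) (r : V) :
    Nat.card {f : V → V // IsParentMap r f ∧ ∀ i, i ≠ r → G.Adj i (f i)}
      = Bethe.numSpanningTrees G := by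
  refine Nat.card_congr (Equiv.ofBijective (fun f => ⟨parentGraph r f.1, ?_,
    f.2.1.parentGraph_isTree⟩) ⟨?_, ?_⟩)
  · intro a b hab
    obtain ⟨i, hi, h⟩ := f.2.1.parentGraph_adj.1 hab
    have := f.2.2 i hi
    rwa [← SimpleGraph.mem_edgeSet, ← h, SimpleGraph.mem_edgeSet] at this
  · intro f g hfg
    exact Subtype.ext (f.2.1.parentGraph_injective g.2.1 (congrArg Subtype.val hfg))
  · rintro ⟨T, hle, hT⟩
    obtain ⟨f, hf, rfl⟩ := hT.exists_parentMap r
    exact ⟨⟨f, hf, fun i hi => hle (hf.parentGraph_adj.2 ⟨i, hi, rfl⟩)⟩, rfl⟩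

/-! ### The matrix-tree theorem -/

section MatrixTree

variable {V : Type*} [Fintype V] [DecidableEq V]

/-- The matrix with row `e_r` at the root and rows `e_i - e_{f i}` elsewhere. -/
def parentMatrix (r : V) (f : V → V) : Matrix V V ℝ :=
  Matrix.of fun i => if i = r then Pi.single r 1 else Pi.single i 1 - Pi.single (f i) 1

theorem IsParentMap.det_parentMatrix {r : V} {f : V → V} (hf : IsParentMap r f) :
    (parentMatrix r f).det = 1 := by
  classical
  -- The depth of `i`, the least number of steps to `r`, is one more than that of its parent.
  -- Ordering by depth makes the transpose block triangular with identity blocks.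
  have hne : ∀ i, i ≠ r → Nat.find (hf.reaches i) = Nat.find (hf.reaches (f i)) + 1 := by
    intro i hi
    have h0 : Nat.find (hf.reaches i) ≠ 0 := fun h0 => hi (by
      have := Nat.find_spec (hf.reaches i)
      rwa [h0] at this)
    obtain ⟨n, hn⟩ := Nat.exists_eq_succ_of_ne_zero h0
    apply le_antisymm
    · apply Nat.find_min'
      rw [Function.iterate_succ_apply]
      exact Nat.find_spec (hf.reaches (f i))
    · rw [hn]
      refine Nat.succ_le_succ (Nat.find_min' _ ?_)
      rw [← Function.iterate_succ_apply, ← hn]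
      exact Nat.find_spec (hf.reaches i)
  have hbt : (parentMatrix r f).transpose.BlockTriangular fun i => Nat.find (hf.reaches i) := by
    intro i j hij
    by_cases hj : j = r
    · subst hj
      have : i ≠ j := by rintro rfl; exact lt_irrefl _ hij
      simp [parentMatrix, this]
    · have h1 : i ≠ j := by rintro rfl; exact lt_irrefl _ hij
      have h2 : i ≠ f j := by
        rintro rfl
        have := hne j hj
        simp only at hij
        lia
      simp [parentMatrix, hj, h1, h2]
  rw [← Matrix.det_transpose, hbt.det]
  refine Finset.prod_eq_one fun k _ => ?_
  suffices h : (parentMatrix r f).transpose.toSquareBlock (fun i => Nat.find (hf.reaches i)) k = 1 by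
    rw [h, Matrix.det_one]
  ext ⟨i, hi⟩ ⟨j, hj⟩
  simp only [Matrix.toSquareBlock_def, Matrix.of_apply, Matrix.transpose_apply, parentMatrix,
    Matrix.one_apply, Subtype.mk.injEq]
  by_cases hjr : j = r
  · subst hjr
    simp [Pi.single_apply]
  · have h2 : i ≠ f j := by
      rintro rfl
      have := hne j hjr
      lia
    simp [hjr, Pi.single_apply, h2]

theorem det_parentMatrix_eq_zero {r : V} {f : V → V} (hr : f r = r) (hf : ¬ IsParentMap r f) :
    (parentMatrix r f).det = 0 := by
  classical
  have hex : ∃ i, ∀ k, f^[k] i ≠ r := by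
    by_contra! h
    exact hf ⟨hr, h⟩
  obtain ⟨i₀, hi₀⟩ := hex
  -- The indicator of the vertices whose orbit misses `r` is constant along `f` and vanishes at `r`,
  -- so it lies in the kernel.
  refine Matrix.exists_mulVec_eq_zero_iff.1 ⟨fun i => if ∀ k, f^[k] i ≠ r then 1 else 0, ?_, ?_⟩
  · intro h
    simpa [hi₀] using congrFun h i₀
  · ext i
    simp only [Matrix.mulVec, parentMatrix, Matrix.of_apply, Pi.zero_apply]
    by_cases hi : i = r
    · subst hi
      simp only [if_true, single_dotProduct, one_mul]
      exact if_neg fun h => h 0 rfl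
    · have : (∀ k, f^[k] i ≠ r) ↔ ∀ k, f^[k] (f i) ≠ r := by
        refine ⟨fun h k => h (k + 1), fun h k => ?_⟩
        cases k with
        | zero => exact hi
        | succ k => exact h k
      simp only [if_neg hi, sub_dotProduct, single_dotProduct, one_mul, this, sub_self]

variable (G : SimpleGraph V) [DecidableRel G.Adj]

theorem SimpleGraph.lapMatrix_row_eq_sum (i : V) :
    G.lapMatrix ℝ i = ∑ j ∈ G.neighborFinset i, (Pi.single i 1 - Pi.single j 1) := by
  ext k
  simp only [SimpleGraph.lapMatrix, SimpleGraph.degMatrix, Matrix.sub_apply,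
    Matrix.diagonal_apply, SimpleGraph.adjMatrix_apply, Finset.sum_apply, Pi.sub_apply,
    Finset.sum_sub_distrib, Finset.sum_const, SimpleGraph.card_neighborFinset_eq_degree,
    Pi.single_apply]
  congr 1
  · by_cases h : i = k
    · simp [h]
    · simp [h, Ne.symm h]
  · simp

/-- The matrix-tree theorem for principal minors. -/
theorem SimpleGraph.adjugate_lapMatrix_diag (r : V) :
    (G.lapMatrix ℝ).adjugate r r = Bethe.numSpanningTrees G := by
  classical
  rw [Matrix.adjugate_apply]
  -- The root gets the single choice `r`, so every choice function fixes `r`, as parent maps do.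
  let A : V → Finset V := fun i => if i = r then {r} else G.neighborFinset i
  let g : V → V → V → ℝ := fun i j =>
    if i = r then Pi.single r 1 else Pi.single i 1 - Pi.single j 1
  have hrow : (G.lapMatrix ℝ).updateRow r (Pi.single r 1) = Matrix.of fun i => ∑ j ∈ A i, g i j := by
    ext i k
    by_cases hi : i = r
    · subst hi; simp [A, g]
    · simp only [Matrix.updateRow_ne hi, Matrix.of_apply, A, g, if_neg hi]
      rw [SimpleGraph.lapMatrix_row_eq_sum]
  have hexp := (Matrix.detRowAlternating (n := V) (R := ℝ)).toMultilinearMap.map_sum_finset g A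
  rw [hrow]
  refine Eq.trans hexp ?_
  have hval : ∀ f ∈ Fintype.piFinset A,
      (Matrix.detRowAlternating (n := V) (R := ℝ)).toMultilinearMap (fun i => g i (f i))
        = if IsParentMap r f then 1 else 0 := by
    intro f hf
    have hfr : f r = r := by simpa [A] using Fintype.mem_piFinset.1 hf r
    split_ifs with h
    · exact h.det_parentMatrix
    · exact det_parentMatrix_eq_zero hfr h
  rw [Finset.sum_congr rfl hval, Finset.sum_boole, ← card_parentMaps G r, Nat.card_eq_fintype_card,
    Fintype.card_subtype]
  congr 2
  ext f
  simp only [Finset.mem_filter, Fintype.mem_piFinset, Finset.mem_univ, true_and]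
  constructor
  · rintro ⟨h1, h2⟩
    refine ⟨h2, fun i hi => ?_⟩
    simpa [A, hi] using h1 i
  · rintro ⟨h1, h2⟩
    refine ⟨fun i => ?_, h1⟩
    by_cases hi : i = r
    · subst hi; simpa [A] using h1.map_root
    · simpa [A, hi] using h2 i hi

variable {G} in
/-- The matrix-tree theorem: all cofactors of the Laplacian count the spanning trees. -/
theorem SimpleGraph.Connected.adjugate_lapMatrix (hG : G.Connected) (i j : V) :
    (G.lapMatrix ℝ).adjugate i j = Bethe.numSpanningTrees G := by
  have : Nonempty V := ⟨i⟩
  -- Since `L * adj L = det L • 1 = 0`, each column of the adjugate lies in the kernel of `L`, so it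
  -- is constant on a connected graph.
  have hker : (G.lapMatrix ℝ).mulVec (fun k => (G.lapMatrix ℝ).adjugate k j) = 0 := by
    ext k
    have := congrFun₂ (Matrix.mul_adjugate (G.lapMatrix ℝ)) k j
    rwa [SimpleGraph.det_lapMatrix_eq_zero, zero_smul] at this
  rw [← G.adjugate_lapMatrix_diag j]
  exact (SimpleGraph.lapMatrix_mulVec_eq_zero_iff_forall_reachable G).1 hker i j
    (hG.preconnected i j)

/-! ### The Ihara–Bass matrix near `t = 1` -/

/-- The matrix `I - t A + t² (D - I)` of the Ihara–Bass formula. -/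
def SimpleGraph.iharaMatrix (t : ℝ) : Matrix V V ℝ :=
  Matrix.of fun i j =>
    (if i = j then 1 - t ^ 2 + t ^ 2 * G.degree i else 0) - t * if G.Adj i j then 1 else 0

theorem SimpleGraph.iharaMatrix_one : G.iharaMatrix 1 = G.lapMatrix ℝ := by
  ext i j
  simp [iharaMatrix, lapMatrix, degMatrix, Matrix.diagonal_apply, SimpleGraph.adjMatrix_apply]

theorem SimpleGraph.sum_iharaMatrix (t : ℝ) (j : V) :
    ∑ i, G.iharaMatrix t i j = (1 - t) * (1 + t - t * G.degree j) := by
  have h : ∑ i, (if G.Adj i j then (1 : ℝ) else 0) = G.degree j := by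
    rw [G.degree_eq_sum_if_adj (R := ℝ)]
    simp only [SimpleGraph.adj_comm]
  simp only [iharaMatrix, Matrix.of_apply, Finset.sum_sub_distrib, ← Finset.mul_sum, h,
    Finset.sum_ite_eq', Finset.mem_univ, if_true]
  ring

/-- Replacing row `r` by the sum of all rows keeps the determinant, and that sum is divisible by `1
- t`. -/
theorem SimpleGraph.det_iharaMatrix (r : V) (t : ℝ) :
    (G.iharaMatrix t).det = (1 - t) *
      ((G.iharaMatrix t).updateRow r fun j => 1 + t - t * G.degree j).det := by
  have h := Matrix.det_updateRow_sum (G.iharaMatrix t) r (fun _ => 1)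
  rw [one_smul] at h
  rw [← Matrix.det_updateRow_smul, ← h]
  congr 2
  ext j
  simp only [one_smul, Pi.smul_apply, smul_eq_mul]
  exact (Finset.sum_apply j _ (G.iharaMatrix t)).trans (G.sum_iharaMatrix t j)

theorem Matrix.det_updateRow_eq_sum_adjugate (A : Matrix V V ℝ) (r : V) (w : V → ℝ) :
    (A.updateRow r w).det = ∑ j, w j * A.adjugate j r := by
  rw [Matrix.det_eq_sum_mul_adjugate_row _ r]
  refine Finset.sum_congr rfl fun j _ => ?_
  rw [Matrix.updateRow_self, Matrix.adjugate_apply, Matrix.adjugate_apply, Matrix.updateRow_idem]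

variable {G} in
theorem SimpleGraph.Connected.tendsto_reduced_iharaMatrix (hG : G.Connected) (r : V) :
    Tendsto (fun t => ((G.iharaMatrix t).updateRow r fun j => 1 + t - t * G.degree j).det) (𝓝 1)
      (𝓝 (2 * ((Fintype.card V : ℝ) - G.edgeFinset.card) * Bethe.numSpanningTrees G)) := by
  have hcont : Continuous
      fun t => ((G.iharaMatrix t).updateRow r fun j => 1 + t - t * G.degree j).det := by
    refine Continuous.matrix_det (Continuous.matrix_updateRow r ?_
      (continuous_pi fun j => by fun_prop))
    refine continuous_matrix fun i j => ?_
    simp only [iharaMatrix, Matrix.of_apply]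
    by_cases h : i = j <;> simp only [h, if_true, if_false] <;> fun_prop
  have h := hcont.tendsto 1
  convert h using 2
  rw [SimpleGraph.iharaMatrix_one, Matrix.det_updateRow_eq_sum_adjugate]
  simp only [hG.adjugate_lapMatrix, ← Finset.sum_mul]
  have hdeg : ∑ v, (G.degree v : ℝ) = 2 * G.edgeFinset.card := by
    exact_mod_cast G.sum_degrees_eq_twice_card_edges
  congr 1
  simp only [one_mul, Finset.sum_sub_distrib, hdeg, Finset.sum_const, Finset.card_univ, nsmul_eq_mul]
  ring

end MatrixTree

/-! ### Connected graphs with at most as many edges as vertices -/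

section Unicyclic

variable {V : Type*} {G : SimpleGraph V}

theorem SimpleGraph.card_edgeSet_deleteEdges_singleton [Finite V] {e : Sym2 V}
    (he : e ∈ G.edgeSet) :
    Nat.card (G.deleteEdges {e}).edgeSet + 1 = Nat.card G.edgeSet := by
  rw [Nat.card_coe_set_eq, Nat.card_coe_set_eq, SimpleGraph.edgeSet_deleteEdges,
    Set.ncard_sdiff_singleton_add_one he]

/-- Deleting an edge of a cycle of a connected graph preserves connectedness. -/
theorem SimpleGraph.Connected.deleteEdges_of_mem_cycle (hG : G.Connected) {v : V} {p : G.Walk v v}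
    (hp : p.IsCycle) {e : Sym2 V} (he : e ∈ p.edges) : (G.deleteEdges {e}).Connected := by
  induction e with
  | _ x y =>
    exact hG.connected_delete_edge_of_not_isBridge fun h => h.notMem_edges_of_isCycle hp he

/-- In a connected graph with as many edges as vertices, every cycle contains every edge
of every other cycle. -/
theorem SimpleGraph.Connected.edges_subset_of_isCycle [Finite V] (hG : G.Connected)
    (hcard : Nat.card G.edgeSet = Nat.card V) {v w : V} {p : G.Walk v v} {q : G.Walk w w}
    (hp : p.IsCycle) (hq : q.IsCycle) : p.edges ⊆ q.edges := by
  intro e he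
  by_contra hne
  have htree : (G.deleteEdges {e}).IsTree := by
    refine SimpleGraph.isTree_iff_connected_and_card.2 ⟨hG.deleteEdges_of_mem_cycle hp he, ?_⟩
    rw [← hcard, SimpleGraph.card_edgeSet_deleteEdges_singleton (p.edges_subset_edgeSet he)]
  have hmem : ∀ e' ∈ q.edges, e' ∉ ({e} : Set (Sym2 V)) := by
    rintro e' he' rfl
    exact hne he'
  exact htree.isAcyclic (q.toDeleteEdges {e} hmem) (hq.toDeleteEdges G {e} hmem)

/-- Connectedness gives `M ≥ N - 1`, with equality for trees. If `M = N`, some cycle exists and any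
two share all edges. Conversely, deleting an edge of the only cycle leaves a tree, so `M = N`. -/
theorem SimpleGraph.Connected.card_edgeSet_le_iff [Finite V] (hG : G.Connected) :
    Nat.card G.edgeSet ≤ Nat.card V ↔ G.IsTree ∨ Bethe.HasExactlyOneCycle G := by
  constructor
  · intro hle
    have hge := hG.card_vert_le_card_edgeSet_add_one
    by_cases hT : Nat.card G.edgeSet + 1 = Nat.card V
    · exact Or.inl (SimpleGraph.isTree_iff_connected_and_card.2 ⟨hG, hT⟩)
    · right
      have hcard : Nat.card G.edgeSet = Nat.card V := by lia
      have hnac : ¬ G.IsAcyclic := fun h => hT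
        (SimpleGraph.isTree_iff_connected_and_card.1 ⟨hG, h⟩).2
      simp only [SimpleGraph.IsAcyclic, not_forall, not_not] at hnac
      obtain ⟨v, p, hp⟩ := hnac
      refine ⟨{e | e ∈ p.edges}, ⟨v, p, hp, rfl⟩, ?_⟩
      rintro C ⟨w, q, hq, rfl⟩
      exact Set.Subset.antisymm (hG.edges_subset_of_isCycle hcard hq hp)
        (hG.edges_subset_of_isCycle hcard hp hq)
  · rintro (hT | ⟨C, ⟨v, p, hp, rfl⟩, huniq⟩)
    · have := (SimpleGraph.isTree_iff_connected_and_card.1 hT).2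
      lia
    · obtain ⟨e, he⟩ := List.exists_mem_of_ne_nil p.edges (by
        intro h
        have h3 := hp.three_le_length
        rw [← SimpleGraph.Walk.length_edges, h] at h3
        simp at h3)
      have htree : (G.deleteEdges {e}).IsTree := by
        refine ⟨hG.deleteEdges_of_mem_cycle hp he, fun w q hq => ?_⟩
        have hq' := hq.mapLe (SimpleGraph.deleteEdges_le {e})
        have heq := huniq _ ⟨w, _, hq', rfl⟩
        have hmem : e ∈ (q.mapLe (SimpleGraph.deleteEdges_le {e})).edges := heq.symm.subset he
        rw [SimpleGraph.Walk.edges_mapLe_eq_edges] at hmem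
        have := q.edges_subset_edgeSet hmem
        simp [SimpleGraph.edgeSet_deleteEdges] at this
      have h1 := (SimpleGraph.isTree_iff_connected_and_card.1 htree).2
      rw [SimpleGraph.card_edgeSet_deleteEdges_singleton (p.edges_subset_edgeSet he)] at h1
      exact h1.le

/-- A connected graph with at most as many edges as vertices is covered by the graph of a
self-map of its vertices. -/
theorem SimpleGraph.Connected.exists_map_covering [Finite V] (hG : G.Connected)
    (hcard : Nat.card G.edgeSet ≤ Nat.card V) : ∃ f : V → V, ∀ e ∈ G.edgeSet, ∃ i, e = s(i, f i) := by
  classical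
  obtain ⟨T, hle, hT⟩ := hG.exists_isTree_le
  have hTc := (SimpleGraph.isTree_iff_connected_and_card.1 hT).2
  have hsub := SimpleGraph.edgeSet_mono hle
  by_cases hex : ∃ u v, s(u, v) ∈ G.edgeSet \ T.edgeSet
  · obtain ⟨u, v, huv⟩ := hex
    obtain ⟨f, hf, rfl⟩ := hT.exists_parentMap u
    -- At most one edge lies outside the spanning tree. Rooting the tree at an end `u` of it leaves
    -- the value at `u` free to cover that edge.
    refine ⟨Function.update f u v, fun e he => ?_⟩
    by_cases heT : e ∈ (parentGraph u f).edgeSet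
    · induction e with
      | _ a b =>
        obtain ⟨i, hi, h⟩ := hf.parentGraph_adj.1 heT
        exact ⟨i, by rw [Function.update_of_ne hi, h]⟩
    · refine ⟨u, ?_⟩
      rw [Function.update_self]
      have h1 : (G.edgeSet \ (parentGraph u f).edgeSet).ncard ≤ 1 := by
        have := Set.ncard_sdiff_add_ncard_of_subset hsub
        rw [Nat.card_coe_set_eq] at hTc hcard
        lia
      exact (Set.ncard_le_one (Set.toFinite _)).1 h1 _ ⟨he, heT⟩ _ huv
  · obtain ⟨r⟩ := hG.nonempty
    obtain ⟨f, hf, rfl⟩ := hT.exists_parentMap r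
    refine ⟨f, fun e he => ?_⟩
    induction e with
    | _ a b =>
      have heT : s(a, b) ∈ (parentGraph r f).edgeSet := by
        by_contra h
        exact hex ⟨a, b, he, h⟩
      obtain ⟨i, -, h⟩ := hf.parentGraph_adj.1 heT
      exact ⟨i, h⟩

end Unicyclic

/-! ### Hessians of sums of `η` of affine forms, and edge orientations -/

namespace Bethe

section Hessian

variable {ι κ : Type*} [Fintype ι] [DecidableEq ι] [Fintype κ]

theorem hasDerivAt_eta {x : ℝ} (hx : x ≠ 0) : HasDerivAt eta (Real.log x + 1) x :=
  Real.hasDerivAt_mul_log hx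

theorem hasDerivAt_affine_line {ι : Type*} (a : ℝ) (l : (ι → ℝ) →ₗ[ℝ] ℝ) (q v : ι → ℝ) :
    HasDerivAt (fun s : ℝ => a + l (q + s • v)) (l v) 0 := by
  have h : (fun s : ℝ => a + l (q + s • v)) = fun s => a + l q + s * l v := by
    ext s
    rw [map_add, map_smul, smul_eq_mul, add_assoc]
  rw [h]
  simpa using ((hasDerivAt_id (0 : ℝ)).mul_const (l v)).const_add (a + l q)

/-- The Hessian of a linear function plus a combination of the terms `η(a_k + l_k)`. -/
theorem hessian_linear_add_sum_eta (c a : κ → ℝ) (l : κ → (ι → ℝ) →ₗ[ℝ] ℝ)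
    (l₀ : (ι → ℝ) →ₗ[ℝ] ℝ) {q : ι → ℝ} (hq : ∀ k, 0 < a k + l k q) (i j : ι) :
    hessian (fun q => l₀ q + ∑ k, c k * eta (a k + l k q)) q i j
      = ∑ k, c k * (l k (Pi.single i 1) * l k (Pi.single j 1) / (a k + l k q)) := by
  have hfirst : ∀ q, (∀ k, 0 < a k + l k q) →
      partialDeriv j (fun q => l₀ q + ∑ k, c k * eta (a k + l k q)) q
        = l₀ (Pi.single j 1)
          + ∑ k, c k * ((Real.log (a k + l k q) + 1) * l k (Pi.single j 1)) := by
    intro q hq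
    refine HasLineDerivAt.lineDeriv ?_
    refine HasDerivAt.add ?_ (HasDerivAt.fun_sum fun k _ => HasDerivAt.const_mul _ ?_)
    · simpa using hasDerivAt_affine_line 0 l₀ q (Pi.single j 1)
    · have h1 := hasDerivAt_affine_line (a k) (l k) q (Pi.single j 1)
      refine HasDerivAt.comp (h₂ := eta) 0 ?_ h1
      simpa using hasDerivAt_eta (hq k).ne'
  -- Differentiating again requires the first derivative on a neighbourhood of `q`; positivity is an
  -- open condition.
  have hopen : ∀ᶠ q' in 𝓝 q, ∀ k, 0 < a k + l k q' := by
    refine eventually_all.2 fun k => ?_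
    have hc : Continuous fun q' => a k + l k q' :=
      continuous_const.add (l k).continuous_of_finiteDimensional
    exact hc.continuousAt.eventually (lt_mem_nhds (hq k))
  simp only [hessian, Matrix.of_apply]
  have heq : partialDeriv j (fun q => l₀ q + ∑ k, c k * eta (a k + l k q)) =ᶠ[𝓝 q] fun q =>
      l₀ (Pi.single j 1) + ∑ k, c k * ((Real.log (a k + l k q) + 1) * l k (Pi.single j 1)) :=
    hopen.mono hfirst
  rw [partialDeriv, heq.lineDeriv_eq]
  refine HasLineDerivAt.lineDeriv ?_
  refine HasDerivAt.const_add _ (HasDerivAt.fun_sum fun k _ => HasDerivAt.const_mul _ ?_)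
  have h1 := (hasDerivAt_affine_line (a k) (l k) q (Pi.single i 1)).log
    (by simpa using (hq k).ne')
  convert (h1.add_const 1).mul_const (l k (Pi.single j 1)) using 1
  simp
  ring

end Hessian

theorem sum_units (f : ℤˣ → ℝ) : ∑ x, f x = f 1 + f (-1) := by
  rw [UnitsInt.univ, Finset.sum_pair (by decide)]

@[simp] theorem spin_one : spin 1 = 1 := by simp [spin]

@[simp] theorem spin_neg_one : spin (-1) = -1 := by simp [spin]

section Graph

theorem exists_endpoints {V : Type*} (G : SimpleGraph V) :
    ∃ u v : G.edgeSet → V, ∀ e : G.edgeSet, (e : Sym2 V) = s(u e, v e) := by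
  have : ∀ e : G.edgeSet, ∃ p : V × V, (e : Sym2 V) = s(p.1, p.2) := fun e =>
    ⟨_, (Quot.out_eq (e : Sym2 V)).symm⟩
  choose p hp using this
  exact ⟨fun e => (p e).1, fun e => (p e).2, hp⟩

theorem adj_of_endpoints {V : Type*} {G : SimpleGraph V} {u v : G.edgeSet → V}
    (huv : ∀ e : G.edgeSet, (e : Sym2 V) = s(u e, v e)) (e : G.edgeSet) : G.Adj (u e) (v e) := by
  have := e.2
  rwa [huv e] at this

variable {V : Type*} [Fintype V] [DecidableEq V] {G : SimpleGraph V} [DecidableRel G.Adj]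
  {u v : G.edgeSet → V}

/-- A sum over both orientations of every edge is a sum over ordered pairs of neighbours. -/
theorem sum_edges_add_swap (huv : ∀ e : G.edgeSet, (e : Sym2 V) = s(u e, v e))
    (g : V → V → ℝ) :
    ∑ e, (g (u e) (v e) + g (v e) (u e)) = ∑ i, ∑ j, if G.Adj i j then g i j else 0 := by
  have hne : ∀ e, (u e, v e) ≠ (v e, u e) := fun e h =>
    (adj_of_endpoints huv e).ne (Prod.ext_iff.1 h).1
  have hun : (Finset.univ.biUnion fun e => {(u e, v e), (v e, u e)} : Finset (V × V))
      = Finset.univ.filter fun p => G.Adj p.1 p.2 := by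
    ext ⟨i, j⟩
    simp only [Finset.mem_biUnion, Finset.mem_univ, true_and, Finset.mem_insert,
      Finset.mem_singleton, Finset.mem_filter, Prod.mk.injEq]
    constructor
    · rintro ⟨e, ⟨rfl, rfl⟩ | ⟨rfl, rfl⟩⟩
      · exact adj_of_endpoints huv e
      · exact (adj_of_endpoints huv e).symm
    · intro h
      exact ⟨⟨s(i, j), h⟩, Sym2.eq_iff.1 (huv ⟨s(i, j), h⟩)⟩
  rw [← Fintype.sum_prod_type' (f := fun i j => if G.Adj i j then g i j else 0),
    ← Finset.sum_filter, ← hun, Finset.sum_biUnion]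
  · exact Finset.sum_congr rfl fun e _ => (Finset.sum_pair (f := fun p => g p.1 p.2) (hne e)).symm
  · intro e _ e' _ hee'
    refine Finset.disjoint_left.2 fun p hp hp' => hee' (Subtype.ext ?_)
    rw [huv e, huv e']
    simp only [Finset.mem_insert, Finset.mem_singleton] at hp hp'
    rcases hp with rfl | rfl <;> rcases hp' with h | h <;>
      obtain ⟨h1, h2⟩ := Prod.mk.inj h <;> rw [h1, h2]
    · exact Sym2.eq_swap
    · exact Sym2.eq_swap

theorem freeEnergy_eq (huv : ∀ e : G.edgeSet, (e : Sym2 V) = s(u e, v e))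
    (J : G.edgeSet → ℝ) (h : V → ℝ) (q : Coord G → ℝ) :
    freeEnergy G J h q = -(∑ e : G.edgeSet, J e * q (Sum.inr e)) - ∑ i : V, h i * q (Sum.inl i)
      + ∑ e : G.edgeSet, ∑ x : ℤˣ, ∑ y : ℤˣ, eta ((1 + q (Sum.inl (u e)) * spin x
        + q (Sum.inl (v e)) * spin y + q (Sum.inr e) * spin x * spin y) / 4)
      + ∑ i : V, (1 - (G.degree i : ℝ)) * ∑ x : ℤˣ, eta ((1 + q (Sum.inl i) * spin x) / 2) := by
  simp only [freeEnergy, edgeEntropy, huv, Sym2.lift_mk]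

end Graph

end Bethe

/-! ### The Hessian along the path and the limit of its determinant -/

namespace Bethe

section PathHessian

variable {V : Type*} [Fintype V] [DecidableEq V] {G : SimpleGraph V} [DecidableRel G.Adj]
  {u v : G.edgeSet → V}

theorem path_mem_domain {V : Type*} (G : SimpleGraph V) {t : ℝ} (h1 : -1 < t) (h2 : t < 1) :
    path G t ∈ domain G := by
  refine ⟨fun i x => by simp [path], fun i j hij x y => ?_⟩
  rcases Int.units_eq_one_or x with rfl | rfl <;> rcases Int.units_eq_one_or y with rfl | rfl <;>
    simp [path] <;> linarith

/-- The linear part of the edge pseudomarginal. -/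
def edgeForm {V : Type*} {G : SimpleGraph V} (u v : G.edgeSet → V) (e : G.edgeSet) (x y : ℤˣ) :
    (Coord G → ℝ) →ₗ[ℝ] ℝ :=
  (spin x / 4) • LinearMap.proj (Sum.inl (u e)) + (spin y / 4) • LinearMap.proj (Sum.inl (v e))
    + (spin x * spin y / 4) • LinearMap.proj (Sum.inr e)

/-- The linear part of the vertex pseudomarginal. -/
def vertexForm {V : Type*} (G : SimpleGraph V) (i : V) (x : ℤˣ) : (Coord G → ℝ) →ₗ[ℝ] ℝ :=
  (spin x / 2) • LinearMap.proj (Sum.inl i)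

/-- The energy part of the Bethe free energy. -/
def energyForm (J : G.edgeSet → ℝ) (h : V → ℝ) : (Coord G → ℝ) →ₗ[ℝ] ℝ :=
  -(∑ e : G.edgeSet, J e • LinearMap.proj (Sum.inr e)) - ∑ i : V, h i • LinearMap.proj (Sum.inl i)

theorem energyForm_apply {V : Type*} [Fintype V] {G : SimpleGraph V} [DecidableRel G.Adj]
    (J : G.edgeSet → ℝ) (h : V → ℝ) (q : Coord G → ℝ) :
    energyForm J h q = -(∑ e : G.edgeSet, J e * q (Sum.inr e)) - ∑ i : V, h i * q (Sum.inl i) := by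
  simp [energyForm, LinearMap.sum_apply]

theorem edgeForm_apply {V : Type*} {G : SimpleGraph V} {u v : G.edgeSet → V} (e : G.edgeSet)
    (x y : ℤˣ) (q : Coord G → ℝ) :
    edgeForm u v e x y q = (q (Sum.inl (u e)) * spin x + q (Sum.inl (v e)) * spin y
      + q (Sum.inr e) * spin x * spin y) / 4 := by
  simp only [edgeForm, LinearMap.add_apply, LinearMap.smul_apply, LinearMap.proj_apply,
    smul_eq_mul]
  ring

theorem vertexForm_apply {V : Type*} {G : SimpleGraph V} (i : V) (x : ℤˣ) (q : Coord G → ℝ) :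
    vertexForm G i x q = q (Sum.inl i) * spin x / 2 := by
  simp only [vertexForm, LinearMap.smul_apply, LinearMap.proj_apply, smul_eq_mul]
  ring

theorem hessian_freeEnergy_path (huv : ∀ e : G.edgeSet, (e : Sym2 V) = s(u e, v e))
    (J : G.edgeSet → ℝ) (h : V → ℝ) {t : ℝ} (h1 : -1 < t) (h2 : t < 1) (a b : Coord G) :
    hessian (freeEnergy G J h) (path G t) a b
      = ∑ e, ∑ x, ∑ y, edgeForm u v e x y (Pi.single a 1) * edgeForm u v e x y (Pi.single b 1)
          / ((1 + t * (spin x * spin y)) / 4)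
        + ∑ i, (1 - (G.degree i : ℝ)) *
          ∑ x, vertexForm G i x (Pi.single a 1) * vertexForm G i x (Pi.single b 1) / (1 / 2) := by
  let c : (G.edgeSet × ℤˣ × ℤˣ) ⊕ (V × ℤˣ) → ℝ :=
    Sum.elim (fun _ => 1) (fun p => 1 - (G.degree p.1 : ℝ))
  let k : (G.edgeSet × ℤˣ × ℤˣ) ⊕ (V × ℤˣ) → ℝ := Sum.elim (fun _ => 1 / 4) (fun _ => 1 / 2)
  let l : (G.edgeSet × ℤˣ × ℤˣ) ⊕ (V × ℤˣ) → (Coord G → ℝ) →ₗ[ℝ] ℝ :=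
    Sum.elim (fun p => edgeForm u v p.1 p.2.1 p.2.2) (fun p => vertexForm G p.1 p.2)
  have hF : freeEnergy G J h = fun q => energyForm J h q + ∑ p, c p * eta (k p + l p q) := by
    ext q
    rw [freeEnergy_eq huv, energyForm_apply, add_assoc]
    congr 1
    simp only [Fintype.sum_sum_type, Fintype.sum_prod_type, c, k, l, Sum.elim_inl, Sum.elim_inr,
      one_mul, Finset.mul_sum, edgeForm_apply, vertexForm_apply]
    congr 1
    · refine Finset.sum_congr rfl fun e _ => Finset.sum_congr rfl fun x _ =>
        Finset.sum_congr rfl fun y _ => ?_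
      congr 1
      ring
    · refine Finset.sum_congr rfl fun e _ => Finset.sum_congr rfl fun x _ => ?_
      congr 2
      ring
  have hval : ∀ e x y, 1 / 4 + edgeForm u v e x y (path G t) = (1 + t * (spin x * spin y)) / 4 := by
    intro e x y
    simp only [edgeForm_apply, path, Sum.elim_inl, Sum.elim_inr]
    ring
  have hval' : ∀ i x, 1 / 2 + vertexForm G i x (path G t) = 1 / 2 := by
    intro i x
    simp [vertexForm_apply, path]
  have hpos : ∀ p, 0 < k p + l p (path G t) := by
    rintro (⟨e, x, y⟩ | ⟨i, x⟩)
    · simp only [k, l, Sum.elim_inl, hval]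
      rcases Int.units_eq_one_or x with rfl | rfl <;>
        rcases Int.units_eq_one_or y with rfl | rfl <;> simp <;> linarith
    · simp only [k, l, Sum.elim_inr, hval']
      norm_num
  rw [hF, hessian_linear_add_sum_eta c k l _ hpos]
  simp only [Fintype.sum_sum_type, Fintype.sum_prod_type, c, k, l, Sum.elim_inl, Sum.elim_inr,
      one_mul, Finset.mul_sum, hval, hval']

/-- Each edge adds `1/(1 - t²)` to the diagonal entries of its ends and of itself, and `-t/(1 - t²)`
between its ends. Vertex terms add `1 - d_i`. Mixed entries cancel under `(x, y) ↦ (-x, -y)`. -/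
theorem hessian_path_eq_fromBlocks (J : G.edgeSet → ℝ) (h : V → ℝ) {t : ℝ} (h1 : -1 < t)
    (h2 : t < 1) :
    hessian (freeEnergy G J h) (path G t) =
      Matrix.fromBlocks ((1 - t ^ 2)⁻¹ • G.iharaMatrix t) 0 0
        ((1 - t ^ 2)⁻¹ • (1 : Matrix G.edgeSet G.edgeSet ℝ)) := by
  obtain ⟨u, v, huv⟩ := exists_endpoints G
  have hp : 1 + t ≠ 0 := by linarith
  have hm : 1 - t ≠ 0 := by linarith
  have hs : 1 - t ^ 2 = (1 + t) * (1 - t) := by ring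
  have hs0 : 1 - t ^ 2 ≠ 0 := by rw [hs]; exact mul_ne_zero hp hm
  have hm' : 1 + -t ≠ 0 := by rwa [← sub_eq_add_neg]
  ext a b
  rw [hessian_freeEnergy_path huv J h h1 h2]
  simp only [sum_units, spin_one, spin_neg_one, edgeForm_apply, vertexForm_apply, mul_one, mul_neg,
    neg_neg]
  rcases a with a | a <;> rcases b with b | b
  · let δ : V → V → ℝ := fun i j => if j = i then 1 else 0
    have hδ : ∀ i j : V, (Pi.single (Sum.inl i) 1 : Coord G → ℝ) (Sum.inl j) = δ i j := by
      intro i j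
      simp [δ, Pi.single_apply]
    have hδ' : ∀ (i : V) (e : G.edgeSet), (Pi.single (Sum.inl i) 1 : Coord G → ℝ) (Sum.inr e) = 0 := by
      intro i e
      simp
    simp only [hδ, hδ', Matrix.fromBlocks_apply₁₁, Matrix.smul_apply, SimpleGraph.iharaMatrix,
      Matrix.of_apply, smul_eq_mul]
    have hsum := sum_edges_add_swap huv
      (fun i j => (1 - t ^ 2)⁻¹ * (δ a i * δ b i - t * (δ a i * δ b j)))
    have hright : (∑ i, ∑ j, if G.Adj i j then
        (1 - t ^ 2)⁻¹ * (δ a i * δ b i - t * (δ a i * δ b j)) else 0)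
          = (1 - t ^ 2)⁻¹ * ((if a = b then (G.degree a : ℝ) else 0)
            - t * if G.Adj a b then 1 else 0) := by
      rw [Finset.sum_eq_single a]
      · have hterm : ∀ j, (if G.Adj a j then
            (1 - t ^ 2)⁻¹ * (δ a a * δ b a - t * (δ a a * δ b j)) else 0)
              = (1 - t ^ 2)⁻¹ * (δ b a * (if G.Adj a j then 1 else 0)
                - t * if j = b then (if G.Adj a j then 1 else 0) else 0) := by
          intro j
          by_cases hj : G.Adj a j <;> simp [δ, hj]
        simp only [hterm, ← Finset.mul_sum, Finset.sum_sub_distrib, Finset.sum_ite_eq',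
          Finset.mem_univ, if_true]
        rw [← G.degree_eq_sum_if_adj]
        simp [δ]
      · intro i _ hi
        simp [δ, hi]
      · simp
    rw [hright] at hsum
    have hvert : ∑ i, (1 - (G.degree i : ℝ)) * (δ a i / 2 * (δ b i / 2) / (1 / 2)
        + -(δ a i) / 2 * (-(δ b i) / 2) / (1 / 2)) = if a = b then 1 - (G.degree a : ℝ) else 0 := by
      rw [Finset.sum_eq_single a]
      · by_cases hab : a = b <;> simp [δ, hab]
        ring
      · intro i _ hi
        simp [δ, hi]
      · simp
    rw [hvert]
    have hexp : (1 - t ^ 2)⁻¹ * ((if a = b then 1 - t ^ 2 + t ^ 2 * (G.degree a : ℝ) else 0)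
        - t * if G.Adj a b then 1 else 0)
        = (1 - t ^ 2)⁻¹ * ((if a = b then (G.degree a : ℝ) else 0)
            - t * if G.Adj a b then 1 else 0) + if a = b then 1 - (G.degree a : ℝ) else 0 := by
      by_cases hab : a = b
      · simp only [hab, if_true]
        field_simp
        ring
      · simp [hab]
    rw [hexp, ← hsum]
    congr 1
    refine Finset.sum_congr rfl fun e _ => ?_
    rw [hs]
    field_simp
    ring
  · have h0 : ∀ i : V, (Pi.single (Sum.inr b) 1 : Coord G → ℝ) (Sum.inl i) = 0 := by simp
    have h0' : ∀ e : G.edgeSet, (Pi.single (Sum.inl a) 1 : Coord G → ℝ) (Sum.inr e) = 0 := by simp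
    simp only [h0, h0', Matrix.fromBlocks_apply₁₂, Matrix.zero_apply]
    rw [Finset.sum_eq_zero, Finset.sum_eq_zero, add_zero]
    · intro i _
      ring
    · intro e _
      ring
  · have h0 : ∀ i : V, (Pi.single (Sum.inr a) 1 : Coord G → ℝ) (Sum.inl i) = 0 := by simp
    have h0' : ∀ e : G.edgeSet, (Pi.single (Sum.inl b) 1 : Coord G → ℝ) (Sum.inr e) = 0 := by simp
    simp only [h0, h0', Matrix.fromBlocks_apply₂₁, Matrix.zero_apply]
    rw [Finset.sum_eq_zero, Finset.sum_eq_zero, add_zero]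
    · intro i _
      ring
    · intro e _
      ring
  · have h0 : ∀ (c : G.edgeSet) (i : V), (Pi.single (Sum.inr c) 1 : Coord G → ℝ) (Sum.inl i) = 0 := by
      simp
    have h0' : ∀ c e : G.edgeSet, (Pi.single (Sum.inr c) 1 : Coord G → ℝ) (Sum.inr e)
        = if e = c then 1 else 0 := by
      intro c e
      simp [Pi.single_apply]
    simp only [h0, h0', Matrix.fromBlocks_apply₂₂, Matrix.smul_apply, Matrix.one_apply, smul_eq_mul]
    rw [Finset.sum_eq_single a, Finset.sum_eq_zero]
    · rw [hs]
      by_cases hab : a = b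
      · simp only [hab, if_true]
        field_simp
        ring
      · simp [hab]
    · intro i _
      ring
    · intro e _ he
      simp [he]
    · simp

theorem det_hessian_path (J : G.edgeSet → ℝ) (h : V → ℝ) {t : ℝ} (h1 : -1 < t) (h2 : t < 1) :
    (hessian (freeEnergy G J h) (path G t)).det
      = (1 - t ^ 2)⁻¹ ^ (G.edgeFinset.card + Fintype.card V) * (G.iharaMatrix t).det := by
  rw [hessian_path_eq_fromBlocks J h h1 h2, Matrix.det_fromBlocks_zero₂₁, Matrix.det_smul,
    Matrix.det_smul, Matrix.det_one, SimpleGraph.edgeFinset_card, pow_add]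
  ring

theorem tendsto_det_hessian_path (hG : G.Connected) (J : G.edgeSet → ℝ) (h : V → ℝ) :
    Tendsto
      (fun t : ℝ => (hessian (freeEnergy G J h) (path G t)).det
        * (1 - t) ^ ((G.edgeFinset.card : ℤ) + Fintype.card V - 1))
      (𝓝[<] 1)
      (𝓝 (-(2 : ℝ) ^ (-(G.edgeFinset.card : ℤ) - Fintype.card V + 1)
        * ((G.edgeFinset.card : ℝ) - Fintype.card V) * numSpanningTrees G)) := by
  obtain ⟨r⟩ := hG.nonempty
  set M := G.edgeFinset.card
  set N := Fintype.card V
  -- What remains once the `M + N` factors `(1 - t)⁻¹` of the blocks cancel against `(1 - t)^(M + N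
  -- - 1)` and the factor `1 - t` of the Ihara determinant.
  have hlim : Tendsto (fun t : ℝ => ((1 + t) ^ (M + N))⁻¹ *
      ((G.iharaMatrix t).updateRow r fun j => 1 + t - t * G.degree j).det) (𝓝[<] 1)
      (𝓝 (((1 + 1) ^ (M + N))⁻¹ * (2 * ((N : ℝ) - M) * numSpanningTrees G))) := by
    refine Tendsto.mono_left (Tendsto.mul ?_ (hG.tendsto_reduced_iharaMatrix r)) nhdsWithin_le_nhds
    refine ContinuousAt.tendsto (f := fun t : ℝ => ((1 + t) ^ (M + N))⁻¹) ?_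
    exact ContinuousAt.inv₀ (by fun_prop) (by norm_num)
  have hval : ((1 + 1 : ℝ) ^ (M + N))⁻¹ * (2 * ((N : ℝ) - M) * numSpanningTrees G)
      = -(2 : ℝ) ^ (-(M : ℤ) - N + 1) * ((M : ℝ) - N) * numSpanningTrees G := by
    have : (2 : ℝ) ^ (-(M : ℤ) - N + 1) = ((1 + 1 : ℝ) ^ (M + N))⁻¹ * 2 := by
      rw [zpow_add₀ two_ne_zero, zpow_one, ← zpow_natCast, ← zpow_neg]
      norm_num
      ring_nf
    rw [this]
    ring
  rw [← hval]
  refine hlim.congr' ?_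
  filter_upwards [Ioo_mem_nhdsLT (show (-1 : ℝ) < 1 by norm_num)] with t ht
  have hp : 1 + t ≠ 0 := by linarith [ht.1]
  have hm : 1 - t ≠ 0 := by linarith [ht.2]
  rw [det_hessian_path J h ht.1 ht.2, G.det_iharaMatrix r, zpow_sub_one₀ hm,
    show (M : ℤ) + N = ((M + N : ℕ) : ℤ) by push_cast; rfl, zpow_natCast,
    show 1 - t ^ 2 = (1 + t) * (1 - t) by ring, inv_pow, mul_pow]
  field_simp
  simp only [M, N]
  ring

end PathHessian

end Bethe

/-! ### Convexity for `M ≤ N` and its failure for `M > N` -/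

namespace Bethe

section Convexity

theorem convexOn_finset_sum {E ι : Type*} [AddCommGroup E] [Module ℝ E] {s : Set E}
    (hs : Convex ℝ s) (t : Finset ι) {f : ι → E → ℝ} (hf : ∀ i ∈ t, ConvexOn ℝ s (f i)) :
    ConvexOn ℝ s fun x => ∑ i ∈ t, f i x := by
  classical
  induction t using Finset.induction_on with
  | empty => simpa using convexOn_const 0 hs
  | insert i t hi ih =>
    simp only [Finset.sum_insert hi]
    exact (hf i (Finset.mem_insert_self i t)).add
      (ih fun j hj => hf j (Finset.mem_insert_of_mem hj))

/-- The perspective of `η` is jointly convex. -/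
theorem eta_sub_mul_log_le {u₁ u₂ v₁ v₂ a b : ℝ} (hu₁ : 0 < u₁) (hu₂ : 0 < u₂)
    (hv₁ : 0 < v₁) (hv₂ : 0 < v₂) (ha : 0 < a) (hb : 0 < b) :
    eta (a * u₁ + b * u₂) - (a * u₁ + b * u₂) * Real.log (a * v₁ + b * v₂)
      ≤ a * (eta u₁ - u₁ * Real.log v₁) + b * (eta u₂ - u₂ * Real.log v₂) := by
  have hv : 0 < a * v₁ + b * v₂ := by positivity
  have hu : 0 < a * u₁ + b * u₂ := by positivity
  -- Jensen for `η` at the ratios `u₁/v₁` and `u₂/v₂`, with weights proportional to `a v₁` and `b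
  -- v₂`; multiplying by the total weight gives the claim.
  have h := Real.convexOn_mul_log.2 (Set.mem_Ici.2 (div_pos hu₁ hv₁).le)
    (Set.mem_Ici.2 (div_pos hu₂ hv₂).le)
    (show 0 ≤ a * v₁ / (a * v₁ + b * v₂) by positivity)
    (show 0 ≤ b * v₂ / (a * v₁ + b * v₂) by positivity)
    (by rw [← add_div, div_self hv.ne'])
  simp only [smul_eq_mul] at h
  have hmean : a * v₁ / (a * v₁ + b * v₂) * (u₁ / v₁) + b * v₂ / (a * v₁ + b * v₂) * (u₂ / v₂)
      = (a * u₁ + b * u₂) / (a * v₁ + b * v₂) := by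
    field_simp
  rw [hmean, Real.log_div hu.ne' hv.ne', Real.log_div hu₁.ne' hv₁.ne',
    Real.log_div hu₂.ne' hv₂.ne'] at h
  have h' := mul_le_mul_of_nonneg_left h hv.le
  simp only [eta]
  calc _ = (a * v₁ + b * v₂) * ((a * u₁ + b * u₂) / (a * v₁ + b * v₂)
        * (Real.log (a * u₁ + b * u₂) - Real.log (a * v₁ + b * v₂))) := by
          field_simp
    _ ≤ _ := h'
    _ = _ := by field_simp

theorem convexOn_of_pos {E : Type*} [AddCommGroup E] [Module ℝ E] {s : Set E} (hs : Convex ℝ s)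
    {f : E → ℝ} (hf : ∀ x ∈ s, ∀ y ∈ s, ∀ a b : ℝ, 0 < a → 0 < b → a + b = 1 →
      f (a • x + b • y) ≤ a * f x + b * f y) : ConvexOn ℝ s f :=
  convexOn_iff_forall_pos.2 ⟨hs, fun x hx y hy a b ha hb hab => hf x hx y hy a b ha hb hab⟩

theorem convex_domain {V : Type*} (G : SimpleGraph V) : Convex ℝ (domain G) := by
  refine convex_iff_forall_pos.2 fun p hp q hq a b ha hb hab => ⟨fun i x => ?_, fun i j hij x y => ?_⟩
  · have h1 := mul_pos ha (hp.1 i x)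
    have h2 := mul_pos hb (hq.1 i x)
    simp only [Pi.add_apply, Pi.smul_apply, smul_eq_mul]
    linear_combination h1 + h2 + hab
  · have h1 := mul_pos ha (hp.2 i j hij x y)
    have h2 := mul_pos hb (hq.2 i j hij x y)
    simp only [Pi.add_apply, Pi.smul_apply, smul_eq_mul]
    linear_combination h1 + h2 + hab

theorem convexOn_vertex_eta {V : Type*} (G : SimpleGraph V) (i : V) (x : ℤˣ) :
    ConvexOn ℝ (domain G) fun q => eta ((1 + q (Sum.inl i) * spin x) / 2) := by
  refine convexOn_of_pos (convex_domain G) fun p hp q hq a b ha hb hab => ?_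
  have h1 := hp.1 i x
  have h2 := hq.1 i x
  have h := Real.convexOn_mul_log.2 (x := (1 + p (Sum.inl i) * spin x) / 2)
    (y := (1 + q (Sum.inl i) * spin x) / 2) (Set.mem_Ici.2 (by positivity))
    (Set.mem_Ici.2 (by positivity)) ha.le hb.le hab
  have harg : (1 + (a • p + b • q) (Sum.inl i) * spin x) / 2
      = a • ((1 + p (Sum.inl i) * spin x) / 2) + b • ((1 + q (Sum.inl i) * spin x) / 2) := by
    simp only [Pi.add_apply, Pi.smul_apply, smul_eq_mul]
    linear_combination -(1 / 2) * hab
  rw [harg]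
  exact h

/-- Minus the conditional entropy along an edge, term by term. -/
theorem convexOn_edge_conditional {V : Type*} {G : SimpleGraph V} {i j : V} (hij : G.Adj i j)
    {e : G.edgeSet} (he : (e : Sym2 V) = s(i, j)) (x y : ℤˣ) :
    ConvexOn ℝ (domain G) fun q =>
      eta ((1 + q (Sum.inl i) * spin x + q (Sum.inl j) * spin y
          + q (Sum.inr e) * spin x * spin y) / 4)
        - (1 + q (Sum.inl i) * spin x + q (Sum.inl j) * spin y
          + q (Sum.inr e) * spin x * spin y) / 4 * Real.log ((1 + q (Sum.inl j) * spin y) / 2) := by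
  obtain rfl : e = ⟨s(i, j), hij⟩ := Subtype.ext he
  refine convexOn_of_pos (convex_domain G) fun p hp q hq a b ha hb hab => ?_
  have h := eta_sub_mul_log_le (div_pos (hp.2 i j hij x y) four_pos)
    (div_pos (hq.2 i j hij x y) four_pos) (div_pos (hp.1 j y) two_pos)
    (div_pos (hq.1 j y) two_pos) ha hb
  convert h using 3
  · simp only [Pi.add_apply, Pi.smul_apply, smul_eq_mul]
    linear_combination -(1 / 4) * hab
  · simp only [Pi.add_apply, Pi.smul_apply, smul_eq_mul]
    linear_combination -(1 / 4) * hab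
  · simp only [Pi.add_apply, Pi.smul_apply, smul_eq_mul]
    congr 1
    linear_combination -(1 / 2) * hab

variable {V : Type*} [Fintype V] [DecidableEq V] {G : SimpleGraph V} [DecidableRel G.Adj]
  {u v : G.edgeSet → V}

theorem sum_degree_mul (huv : ∀ e : G.edgeSet, (e : Sym2 V) = s(u e, v e)) (S : V → ℝ) :
    ∑ i, (1 - (G.degree i : ℝ)) * S i = ∑ i, S i - ∑ e, S (u e) - ∑ e, S (v e) := by
  have h := sum_edges_add_swap huv fun i _ => S i
  have h2 : ∀ i, (∑ j, if G.Adj i j then S i else 0) = (G.degree i : ℝ) * S i := by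
    intro i
    rw [G.degree_eq_sum_if_adj (R := ℝ), Finset.sum_mul]
    simp
  simp only [h2, Finset.sum_add_distrib] at h
  simp only [sub_mul, one_mul, Finset.sum_sub_distrib]
  linarith

/-- If distinct edges have distinct first endpoints, the Bethe free energy splits into convex
terms. -/
theorem freeEnergy_eq_conditional (huv : ∀ e : G.edgeSet, (e : Sym2 V) = s(u e, v e))
    (hu : Function.Injective u) (J : G.edgeSet → ℝ) (h : V → ℝ) (q : Coord G → ℝ) :
    freeEnergy G J h q = energyForm J h q
      + ∑ e, ∑ x, ∑ y, (eta ((1 + q (Sum.inl (u e)) * spin x + q (Sum.inl (v e)) * spin y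
          + q (Sum.inr e) * spin x * spin y) / 4)
        - (1 + q (Sum.inl (u e)) * spin x + q (Sum.inl (v e)) * spin y
          + q (Sum.inr e) * spin x * spin y) / 4
            * Real.log ((1 + q (Sum.inl (v e)) * spin y) / 2))
      + ∑ i ∈ (Finset.univ.image u)ᶜ, ∑ x : ℤˣ, eta ((1 + q (Sum.inl i) * spin x) / 2) := by
  -- Each tail carries one positive entropy sum, which cancels against the term `-S (u e)` of its
  -- edge. Only vertices that are not tails keep theirs.
  have hsplit := Finset.sum_compl_add_sum (Finset.univ.image u) fun i =>
    ∑ x : ℤˣ, eta ((1 + q (Sum.inl i) * spin x) / 2)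
  rw [Finset.sum_image fun _ _ _ _ hab => hu hab] at hsplit
  rw [freeEnergy_eq huv, energyForm_apply, sum_degree_mul huv, ← hsplit]
  -- Summing over the tail spin turns the logarithmic terms into the head entropy, which absorbs `-S
  -- (v e)`.
  have hmarg : ∀ e, ∑ x : ℤˣ, ∑ y : ℤˣ, (1 + q (Sum.inl (u e)) * spin x + q (Sum.inl (v e)) * spin y
          + q (Sum.inr e) * spin x * spin y) / 4
            * Real.log ((1 + q (Sum.inl (v e)) * spin y) / 2)
        = ∑ y : ℤˣ, eta ((1 + q (Sum.inl (v e)) * spin y) / 2) := by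
    intro e
    simp only [sum_units, spin_one, spin_neg_one, eta]
    ring
  simp only [Finset.sum_sub_distrib, hmarg]
  ring

theorem convexOn_freeEnergy (hG : G.Connected) (hcard : G.edgeFinset.card ≤ Fintype.card V)
    (J : G.edgeSet → ℝ) (h : V → ℝ) : ConvexOn ℝ (domain G) (freeEnergy G J h) := by
  obtain ⟨f, hf⟩ := hG.exists_map_covering (by
    rwa [Nat.card_eq_fintype_card, Nat.card_eq_fintype_card, ← SimpleGraph.edgeFinset_card])
  have := hG.nonempty
  choose! b hb using hf
  let u : G.edgeSet → V := fun e => b e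
  let v : G.edgeSet → V := fun e => f (b e)
  have huv : ∀ e : G.edgeSet, (e : Sym2 V) = s(u e, v e) := fun e => hb e e.2
  -- The edge is `s(b e, f (b e))`, so its tail determines it.
  have hu : Function.Injective u := fun e e' hee' => Subtype.ext (by
    rw [huv e, huv e']
    simp only [u, v] at hee' ⊢
    rw [hee'])
  rw [funext (freeEnergy_eq_conditional huv hu J h)]
  have hc := convex_domain G
  refine ((LinearMap.convexOn _ hc).add (convexOn_finset_sum hc _ fun e _ =>
    convexOn_finset_sum hc _ fun x _ => convexOn_finset_sum hc _ fun y _ =>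
      convexOn_edge_conditional (adj_of_endpoints huv e) (huv e) x y)).add
    (convexOn_finset_sum hc _ fun i _ => convexOn_finset_sum hc _ fun x _ =>
      convexOn_vertex_eta G i x)

theorem continuous_eta : Continuous eta := Real.continuous_mul_log

theorem eta_half_lt : 2 * eta (1 / 2) < eta (3 / 4) + eta (1 / 4) := by
  have h := Real.strictConvexOn_mul_log.2 (Set.mem_Ici.2 (show (0 : ℝ) ≤ 3 / 4 by norm_num))
    (Set.mem_Ici.2 (show (0 : ℝ) ≤ 1 / 4 by norm_num)) (by norm_num)
    (show (0 : ℝ) < 1 / 2 by norm_num) (show (0 : ℝ) < 1 / 2 by norm_num) (by norm_num)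
  simp only [smul_eq_mul] at h
  norm_num at h
  simp only [eta]
  norm_num
  linarith

/-- The entropy part of the free energy on the plane of constant magnetization `s` and constant
correlation `t`. -/
def uniformEntropy (M N s t : ℝ) : ℝ :=
  M * (eta ((1 + 2 * s + t) / 4) + 2 * eta ((1 - t) / 4) + eta ((1 - 2 * s + t) / 4))
    + (N - 2 * M) * (eta ((1 + s) / 2) + eta ((1 - s) / 2))

theorem freeEnergy_uniform (J : G.edgeSet → ℝ) (h : V → ℝ) (s t : ℝ) :
    freeEnergy G J h (Sum.elim (fun _ => s) fun _ => t)
      = -(t * ∑ e, J e) - s * ∑ i, h i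
        + uniformEntropy G.edgeFinset.card (Fintype.card V) s t := by
  obtain ⟨u, v, huv⟩ := exists_endpoints G
  have hdeg : ∑ v, (G.degree v : ℝ) = 2 * G.edgeFinset.card := by
    exact_mod_cast G.sum_degrees_eq_twice_card_edges
  rw [freeEnergy_eq huv]
  simp only [Sum.elim_inl, Sum.elim_inr, sum_units, spin_one, spin_neg_one, ← Finset.sum_mul,
    Finset.sum_sub_distrib, hdeg, Finset.sum_const, Finset.card_univ, nsmul_eq_mul,
    ← SimpleGraph.edgeFinset_card, uniformEntropy]
  ring_nf

theorem not_convexOn_freeEnergy (hcard : Fintype.card V < G.edgeFinset.card) (J : G.edgeSet → ℝ)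
    (h : V → ℝ) : ¬ ConvexOn ℝ (domain G) (freeEnergy G J h) := by
  intro hconv
  set M : ℝ := (G.edgeFinset.card : ℝ)
  set N : ℝ := (Fintype.card V : ℝ)
  have hmem : ∀ s t : ℝ, -(1 / 2) ≤ s → s ≤ 1 / 2 → 0 < t → t < 1 →
      (Sum.elim (fun _ => s) fun _ => t) ∈ domain G := by
    intro s t hs1 hs2 ht1 ht2
    refine ⟨fun i x => ?_, fun i j hij x y => ?_⟩
    · rcases Int.units_eq_one_or x with rfl | rfl <;> simp <;> linarith
    · rcases Int.units_eq_one_or x with rfl | rfl <;>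
        rcases Int.units_eq_one_or y with rfl | rfl <;> simp <;> linarith
  -- Midpoint convexity between `s = 1/2` and `s = -1/2`: the entropy is even in `s`, and the linear
  -- terms cancel.
  have hineq : ∀ t ∈ Set.Ioo (0 : ℝ) 1, uniformEntropy M N 0 t ≤ uniformEntropy M N (1 / 2) t := by
    intro t ht
    have hmid := hconv.2 (hmem (1 / 2) t (by norm_num) (by norm_num) ht.1 ht.2)
      (hmem (-(1 / 2)) t (by norm_num) (by norm_num) ht.1 ht.2)
      (show (0 : ℝ) ≤ 1 / 2 by norm_num) (show (0 : ℝ) ≤ 1 / 2 by norm_num) (by norm_num)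
    have hpt : ((1 / 2 : ℝ) • (Sum.elim (fun _ => 1 / 2) fun _ => t)
        + (1 / 2 : ℝ) • (Sum.elim (fun _ => -(1 / 2)) fun _ => t) : Coord G → ℝ)
          = Sum.elim (fun _ => 0) fun _ => t := by
      ext a
      rcases a with a | a <;> simp
      ring
    have heven : uniformEntropy M N (-(1 / 2)) t = uniformEntropy M N (1 / 2) t := by
      simp only [uniformEntropy]
      ring_nf
    rw [hpt, freeEnergy_uniform, freeEnergy_uniform, freeEnergy_uniform, heven] at hmid
    simp only [smul_eq_mul] at hmid
    linarith
  have hcont : ∀ s, Tendsto (fun t => uniformEntropy M N s t) (𝓝[<] 1)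
      (𝓝 (uniformEntropy M N s 1)) := by
    intro s
    have hc := continuous_eta
    have : Continuous fun t => uniformEntropy M N s t := by
      unfold uniformEntropy
      fun_prop
    exact (this.tendsto 1).mono_left nhdsWithin_le_nhds
  -- At `t = 1` the edge terms become vertex entropies, leaving `(N - M) * 2η(1/2) ≤ (N - M) *
  -- (η(3/4) + η(1/4))`, which contradicts strict convexity when `N < M`.
  have hlim := le_of_tendsto_of_tendsto (hcont 0) (hcont (1 / 2))
    (Filter.mem_of_superset (Ioo_mem_nhdsLT one_pos) hineq)
  have hMN : N < M := Nat.cast_lt.2 hcard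
  have h0 : eta 0 = 0 := by simp [eta]
  have hlt := mul_lt_mul_of_pos_left eta_half_lt (sub_pos.2 hMN)
  simp only [uniformEntropy] at hlim
  norm_num [h0] at hlim hlt
  linarith

end Convexity

end Bethe

end

theorem corollary2 {V : Type*} [Fintype V] [DecidableEq V] (G : SimpleGraph V)
    [DecidableRel G.Adj] (hG : G.Connected) (J : G.edgeSet → ℝ) (h : V → ℝ) (N M : ℕ)
    (hN : N = Fintype.card V) (hM : M = G.edgeFinset.card) :
    (∀ t : ℝ, -1 < t → t < 1 → Bethe.path G t ∈ Bethe.domain G) ∧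
    Tendsto
      (fun t : ℝ => (Bethe.hessian (Bethe.freeEnergy G J h) (Bethe.path G t)).det
        * (1 - t) ^ ((M : ℤ) + N - 1))
      (𝓝[<] 1)
      (𝓝 (-(2 : ℝ) ^ (-(M : ℤ) - N + 1) * ((M : ℝ) - N) * Bethe.numSpanningTrees G)) ∧
    ((M : ℤ) - N ≥ 1 → ¬ ConvexOn ℝ (Bethe.domain G) (Bethe.freeEnergy G J h)) ∧
    (ConvexOn ℝ (Bethe.domain G) (Bethe.freeEnergy G J h) ↔
      G.IsTree ∨ Bethe.HasExactlyOneCycle G) := by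
  subst hN hM
  refine ⟨fun t h1 h2 => Bethe.path_mem_domain G h1 h2, Bethe.tendsto_det_hessian_path hG J h,
    fun hMN => Bethe.not_convexOn_freeEnergy (by lia) J h, ?_⟩
  rw [← hG.card_edgeSet_le_iff, Nat.card_eq_fintype_card, Nat.card_eq_fintype_card,
    ← SimpleGraph.edgeFinset_card]
  refine ⟨fun hconv => ?_, fun hle => Bethe.convexOn_freeEnergy hG hle J h⟩
  by_contra hlt
  exact Bethe.not_convexOn_freeEnergy (not_le.1 hlt) J h hconv
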